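/- **Theorem 8.4.** Here a *ring* is an abelian group with an arbitrary bilinear multiplication (not necessarily associative, commutative or unital). For a ring $B$ put $Z(B)=\{b\in B\mid bB=Bb=\{0\}\}$, a two-sided ideal, and let $\pi:B\to B/Z(B)$ be the quotient homomorphism. Let $(R_i)_{i\in I}$ be a family of rings and let $f:\prod_{i\in I}R_i\to B$ be a surjective ring homomorphism. We say that $\pi f$ *factors through finitely many (countably complete) ultraproducts* if there are $n\ge 0$ and ultrafilters (each closed under countable intersections) $\mathcal U_0,\dots,\mathcal U_{n-1}$ on $I$ such that $\pi f$ is the composite of the natural map $\prod_{i\in I}R_i\to\prod_{k<n}\bigl(\prod_{i\in I}R_i/\mathcal U_k\bigr)$ with a ring homomorphism $\prod_{k<n}\bigl(\prod_{i\in I}R_i/\mathcal U_k\bigr)\to B/Z(B)$. Principal ultrafilters count as countably complete. (i) Suppose that $\pi f$ factors through finitely many ultraproducts, but does not factor through finitely many countably complete ultraproducts. Then the additive group of $B/Z(B)$ has a nonzero cotorsion subgroup, where an abelian group $C$ is *cotorsion* if it is a direct summand in every abelian group $A\supseteq C$ such that $A/C$ is torsion-free. Equivalently, the additive group of $B/Z(B)$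 contains a nonzero element of finite order, or a copy of the additive group of $\mathbb Q$, or a copy of the additive group of the $p$-adic integers $\mathbb Z_p$ for some prime $p$. (ii) Suppose that $\operatorname{card}(I)<\kappa$ for every uncountable measurable cardinal $\kappa$ (that is, every $\kappa>\aleph_0$ such that a set of cardinality $\kappa$ carries a nonprincipal ultrafilter closed under intersections of fewer than $\kappa$ sets); this holds in particular if there are no such cardinals. Then $\pi f$ does not factor through finitely many countably complete ultraproducts if and only if there is no finite $J\subseteq I$ such that $\pi f$ factors, via a ring homomorphism, through the projection $\prod_{i\in I}R_i\to\prod_{i\in J}R_i$. -/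

import Mathlib

open Cardinal

universe u

/-- The zero-multiplication ideal `Z(B) = {b ∈ B ∣ b B = B b = 0}` of a ring `B`, where a ring is an
abelian group with an arbitrary bilinear multiplication. -/
def zeroMulIdeal (B : Type*) [NonUnitalNonAssocRing B] : TwoSidedIdeal B :=
  TwoSidedIdeal.mk' {b : B | ∀ x : B, b * x = 0 ∧ x * b = 0}
    (fun x => ⟨zero_mul x, mul_zero x⟩)
    (fun {a b} ha hb x => by
      constructor
      · rw [add_mul, (ha x).1, (hb x).1, add_zero]
      · rw [mul_add, (ha x).2, (hb x).2, add_zero])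
    (fun {a} ha x => by
      constructor
      · rw [neg_mul, (ha x).1, neg_zero]
      · rw [mul_neg, (ha x).2, neg_zero])
    (fun {a b} hb x => by
      rw [(hb a).2]
      exact ⟨zero_mul x, mul_zero x⟩)
    (fun {a b} ha x => by
      rw [(ha b).1]
      exact ⟨zero_mul x, mul_zero x⟩)

/-- The quotient ring `B / Z(B)`. -/
abbrev ModZ (B : Type*) [NonUnitalNonAssocRing B] : Type _ :=
  (zeroMulIdeal B).ringCon.Quotient

/-- The quotient homomorphism `π : B → B / Z(B)`. -/
def piZ (B : Type*) [NonUnitalNonAssocRing B] : B →ₙ+* ModZ B where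
  toFun b := (b : ModZ B)
  map_mul' _ _ := rfl
  map_zero' := rfl
  map_add' _ _ := rfl

section Ultraproducts

variable {I : Type*} (R : I → Type*) [∀ i, NonUnitalNonAssocRing (R i)]

/-- The congruence on `∏ i, R i` identifying two families that agree on a member of the
ultrafilter `U`. -/
def ultraproductCon (U : Ultrafilter I) : RingCon (∀ i, R i) where
  toSetoid := Filter.productSetoid (U : Filter I) R
  mul' h₁ h₂ := by
    filter_upwards [h₁, h₂] with i hi₁ hi₂
    rw [Pi.mul_apply, Pi.mul_apply, hi₁, hi₂]
  add' h₁ h₂ := by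
    filter_upwards [h₁, h₂] with i hi₁ hi₂
    rw [Pi.add_apply, Pi.add_apply, hi₁, hi₂]

/-- The ultraproduct ring `(∏ i, R i) / U`. -/
abbrev Ultraprod (U : Ultrafilter I) : Type _ :=
  (ultraproductCon R U).Quotient

/-- The natural map from `∏ i, R i` to a product of ultraproducts
`(∏ i, R i) / U 0 × ⋯ × (∏ i, R i) / U (n - 1)`. -/
def toUltraprods {n : ℕ} (U : Fin n → Ultrafilter I) :
    (∀ i, R i) →ₙ+* (∀ k, Ultraprod R (U k)) where
  toFun x k := (x : Ultraprod R (U k))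
  map_mul' _ _ := rfl
  map_zero' := rfl
  map_add' _ _ := rfl

/-- The projection from `∏ i, R i` to the product of the finitely many factors with index
in `J`. -/
def toFinsetProd (J : Finset I) : (∀ i, R i) →ₙ+* (∀ i : J, R i) where
  toFun x i := x i
  map_mul' _ _ := rfl
  map_zero' := rfl
  map_add' _ _ := rfl

variable {R} {C : Type*} [NonUnitalNonAssocRing C]

/-- `h : ∏ i, R i → C` factors, via a ring homomorphism, through the natural map to the product of
finitely many (possibly zero) ultraproducts of the `R i`. -/
def FactorsThroughUltraprods (h : (∀ i, R i) →ₙ+* C) : Prop :=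
  ∃ (n : ℕ) (U : Fin n → Ultrafilter I) (g : (∀ k, Ultraprod R (U k)) →ₙ+* C),
    h = g.comp (toUltraprods R U)

/-- `h : ∏ i, R i → C` factors through the natural map to the product of finitely many countably
complete ultraproducts of the `R i`: the ultrafilters are closed under countable intersections
(principal ultrafilters are allowed). -/
def FactorsThroughCountablyCompleteUltraprods (h : (∀ i, R i) →ₙ+* C) : Prop :=
  ∃ (n : ℕ) (U : Fin n → Ultrafilter I) (g : (∀ k, Ultraprod R (U k)) →ₙ+* C),
    (∀ k, CountableInterFilter (U k : Filter I)) ∧ h = g.comp (toUltraprods R U)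

/-- `h : ∏ i, R i → C` factors through the projection to the product of finitely many of
the `R i`. -/
def FactorsThroughFiniteProd (h : (∀ i, R i) →ₙ+* C) : Prop :=
  ∃ (J : Finset I) (g : (∀ i : J, R i) →ₙ+* C), h = g.comp (toFinsetProd R J)

end Ultraproducts

/-- `κ` is an uncountable measurable cardinal: it is uncountable, and some set of cardinality `κ`
carries a nonprincipal ultrafilter closed under intersections of fewer than `κ` sets. -/
def IsUncountableMeasurable (κ : Cardinal.{u}) : Prop :=
  ℵ₀ < κ ∧ ∃ (α : Type u) (U : Ultrafilter α),
    #α = κ ∧ CardinalInterFilter (U : Filter α) κ ∧ ∀ a : α, U ≠ pure a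

/-- An abelian group `C` is cotorsion if it is a direct summand in every overgroup `A` such that
`A / C` is torsion-free; the inclusion of `C` in `A` is written as an injective homomorphism `j`. -/
def IsCotorsion (C : Type u) [AddCommGroup C] : Prop :=
  ∀ (A : Type u) [AddCommGroup A] (j : C →+ A), Function.Injective j →
    IsAddTorsionFree (A ⧸ j.range) → ∃ D : AddSubgroup A, IsCompl j.range D

/-! The proof of (i) isolates `SolvesChains`, a completeness property inherited by homomorphic
images. Every finite part of such a system is solvable in any group, so an ultraproduct over an
ultrafilter that is not countably complete solves the whole system (`solvesChains_ultraprod`). If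
the map factors through finitely many ultraproducts but not through countably complete ones, some
component at a bad ultrafilter has nonzero image, and this image is a nonzero chain-solving subgroup
(`exists_solvesChains_range`).

Such a group is cotorsion: a maximal disjoint subgroup with division-closed sum is a complement,
since it could otherwise be enlarged by a chain of successive quotients
(`exists_larger_complement`). If it is torsion-free, either a nonzero element divisible by all
positive integers yields a copy of `ℚ`, or solving chains defines `z • x` for `p`-adic `z`, and some
resulting map from `ℤ_[p]` is injective.

For (ii), a nonprincipal countably complete ultrafilter on `I` gives an uncountable measurable
cardinal at most `#I`, so here only principal ultrafilters, that is, single factors, remain. -/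

/-- An abelian group `C` solves chains if every system of equations
`e k = c k + q k • e (k + 1)`, `k ∈ ℕ`, with `c k ∈ C` and `q k ∈ ℤ`, is solvable in `C`. -/
def SolvesChains (C : Type*) [AddCommGroup C] : Prop :=
  ∀ (q : ℕ → ℤ) (c : ℕ → C), ∃ e : ℕ → C, ∀ k, e k = c k + q k • e (k + 1)

theorem SolvesChains.of_surjective {M C : Type*} [AddCommGroup M] [AddCommGroup C]
    (hM : SolvesChains M) (φ : M →+ C) (hφ : Function.Surjective φ) : SolvesChains C := by
  intro q c
  choose c' hc' using fun k => hφ (c k)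
  obtain ⟨e, he⟩ := hM q c'
  refine ⟨fun k => φ (e k), fun k => ?_⟩
  simpa only [map_add, map_zsmul, hc'] using congrArg φ (he k)

/-- Back substitution: the term with index `N` is free and may be taken to be zero. -/
theorem exists_chain_solution_lt {G : Type*} [AddCommGroup G] (N : ℕ) (q : ℕ → ℤ) (c : ℕ → G) :
    ∃ e : ℕ → G, ∀ k < N, e k = c k + q k • e (k + 1) := by
  induction N generalizing q c with
  | zero => exact ⟨0, fun k hk => absurd hk (Nat.not_lt_zero k)⟩
  | succ N ih =>
    obtain ⟨e, he⟩ := ih (fun k => q (k + 1)) (fun k => c (k + 1))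
    refine ⟨fun k => Nat.casesOn k (c 0 + q 0 • e 0) e, fun k hk => ?_⟩
    cases k with
    | zero => rfl
    | succ k => exact he k (by omega)

/-! ### Chains in ultraproducts -/

/-- The additive quotient map from `∏ i, R i` onto the ultraproduct. -/
def ultraprodMk {I : Type*} (R : I → Type*) [∀ i, NonUnitalNonAssocRing (R i)]
    (U : Ultrafilter I) : (∀ i, R i) →+ Ultraprod R U where
  toFun x := (x : Ultraprod R U)
  map_zero' := rfl
  map_add' _ _ := rfl

theorem ultraprodMk_surjective {I : Type*} (R : I → Type*) [∀ i, NonUnitalNonAssocRing (R i)]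
    (U : Ultrafilter I) : Function.Surjective (ultraprodMk R U) :=
  Quot.exists_rep

theorem ultraprodMk_eq_iff {I : Type*} {R : I → Type*} [∀ i, NonUnitalNonAssocRing (R i)]
    {U : Ultrafilter I} {x y : ∀ i, R i} :
    ultraprodMk R U x = ultraprodMk R U y ↔ ∀ᶠ i in (U : Filter I), x i = y i :=
  RingCon.eq (ultraproductCon R U)

theorem solvesChains_ultraprod {I : Type*} (R : I → Type*) [∀ i, NonUnitalNonAssocRing (R i)]
    (U : Ultrafilter I) (hU : ¬ CountableInterFilter (U : Filter I)) :
    SolvesChains (Ultraprod R U) := by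
  classical
  obtain ⟨s, hs, hsU⟩ : ∃ s : ℕ → Set I, (∀ n, s n ∈ U) ∧ (⋂ n, s n) ∉ U := by
    by_contra! h
    refine hU ⟨fun S hS hSU => ?_⟩
    rcases S.eq_empty_or_nonempty with rfl | hne
    · simp
    · obtain ⟨s, rfl⟩ := hS.exists_eq_range hne
      rw [Set.sInter_range]
      exact h s fun n => hSU _ ⟨n, rfl⟩
  intro q c
  choose c' hc' using fun k => ultraprodMk_surjective R U (c k)
  -- Coordinate `i` solves only the first `ν i` equations. Equation `k` holds wherever `ν i > k`,
  -- which is ensured off the intersection by membership in `s 0, …, s k`.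
  have hν : ∀ i, ∃ N, i ∉ (⋂ n, s n) → i ∉ s N := by
    intro i
    by_cases hi : i ∈ ⋂ n, s n
    · exact ⟨0, fun h => absurd hi h⟩
    · obtain ⟨N, hN⟩ := not_forall.1 (fun h => hi (Set.mem_iInter.2 h))
      exact ⟨N, fun _ => hN⟩
  choose ν hν using hν
  choose e he using fun i => exists_chain_solution_lt (ν i) q (fun k => c' k i)
  refine ⟨fun k => ultraprodMk R U (fun i => e i k), fun k => ?_⟩
  rw [← hc' k, ← map_zsmul, ← map_add, ultraprodMk_eq_iff]
  have hT : ∀ᶠ i in (U : Filter I), i ∉ ⋂ n, s n :=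
    Ultrafilter.compl_mem_iff_notMem.2 hsU
  have hk : ∀ᶠ i in (U : Filter I), ∀ n ∈ Finset.range (k + 1), i ∈ s n :=
    (Filter.eventually_all_finset _).2 fun n _ => hs n
  filter_upwards [hT, hk] with i hi hik
  refine he i k (not_le.1 fun hle => hν i hi (hik _ ?_))
  exact Finset.mem_range.2 (Nat.lt_succ_of_le hle)

/-! ### Chain-solving groups are cotorsion -/

/-- A subgroup `H` is closed under division by nonzero natural numbers, that is, the quotient by
`H` is torsion-free. -/
def IsDivClosed {A : Type*} [AddCommGroup A] (H : AddSubgroup A) : Prop :=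
  ∀ (n : ℕ), n ≠ 0 → ∀ x : A, n • x ∈ H → x ∈ H

theorem isDivClosed_of_prime {A : Type*} [AddCommGroup A] {H : AddSubgroup A}
    (h : ∀ p : ℕ, p.Prime → ∀ x : A, p • x ∈ H → x ∈ H) : IsDivClosed H := by
  intro n
  induction n using induction_on_primes with
  | zero => exact fun h0 => absurd rfl h0
  | one => intro _ x hx; rwa [one_smul] at hx
  | prime_mul p a hp ih =>
    intro hn x hx
    rw [mul_smul] at hx
    exact ih (right_ne_zero_of_mul hn) x (h p hp _ hx)

theorem isDivClosed_of_quotient {A : Type*} [AddCommGroup A] {H : AddSubgroup A}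
    (h : IsAddTorsionFree (A ⧸ H)) : IsDivClosed H := by
  intro n hn x hx
  rw [← QuotientAddGroup.eq_zero_iff] at hx ⊢
  refine h.nsmul_right_injective hn ?_
  simpa using hx

theorem IsDivClosed.of_zsmul {A : Type*} [AddCommGroup A] {H : AddSubgroup A} (h : IsDivClosed H)
    {m : ℤ} (hm : m ≠ 0) {x : A} (hx : m • x ∈ H) : x ∈ H := by
  refine h m.natAbs (Int.natAbs_ne_zero.2 hm) x ?_
  rcases Int.natAbs_eq m with h' | h'
  · rw [h', natCast_zsmul] at hx
    exact hx
  · rw [h', neg_smul, neg_mem_iff, natCast_zsmul] at hx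
    exact hx

/-- Starting from `a`, a sequence of successive quotients modulo `H` in which each available
division is eventually performed. -/
theorem exists_division_chain {A : Type*} [AddCommGroup A] (H : AddSubgroup A) (a : A) :
    ∃ (y : ℕ → A) (q : ℕ → ℤ), y 0 = a ∧ (∀ k, q k • y (k + 1) - y k ∈ H) ∧
      ∀ (n k : ℕ), ∃ l, k ≤ l ∧ ((∃ w, n • w - y l ∈ H) → q l = n) := by
  have step : ∀ (k : ℕ) (y : A), ∃ (y' : A), ∃ q : ℤ, q • y' - y ∈ H ∧
      ((∃ w, k.unpair.1 • w - y ∈ H) → q = k.unpair.1) := by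
    intro k y
    by_cases h : ∃ w, k.unpair.1 • w - y ∈ H
    · obtain ⟨w, hw⟩ := h
      exact ⟨w, k.unpair.1, by rwa [natCast_zsmul], fun _ => rfl⟩
    · exact ⟨y, 1, by simp, fun h' => absurd h' h⟩
  choose F q hF hq using step
  let y : ℕ → A := fun k => Nat.rec a F k
  refine ⟨y, fun k => q k (y k), rfl, fun k => hF k (y k), fun n k => ?_⟩
  refine ⟨Nat.pair n k, Nat.right_le_pair n k, fun h => ?_⟩
  have := hq (Nat.pair n k) (y (Nat.pair n k))
  rw [Nat.unpair_pair] at this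
  exact this h

/-- A division chain from `a` modulo `K ⊔ D` has errors in both `K` and `D`. Solving a chain in `K`
absorbs the `K`-errors, so the corrected elements `d k` form a division chain modulo `D` alone and
can be adjoined to `D`. -/
theorem exists_larger_complement {A : Type*} [AddCommGroup A] {K D : AddSubgroup A}
    (hK : SolvesChains K) (hKD : Disjoint D K) (hdiv : IsDivClosed (K ⊔ D)) {a : A}
    (ha : a ∉ K ⊔ D) :
    ∃ D' : AddSubgroup A, D < D' ∧ Disjoint D' K ∧ IsDivClosed (K ⊔ D') := by
  obtain ⟨y, q, hy0, hy, hyn⟩ := exists_division_chain (K ⊔ D) a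
  have hKH : K ≤ K ⊔ D := le_sup_left
  have hDH : D ≤ K ⊔ D := le_sup_right
  choose c hc δ hδ hcδ using fun k => AddSubgroup.mem_sup.1 (hy k)
  obtain ⟨e, he⟩ := hK q (fun k => ⟨c k, hc k⟩)
  replace he : ∀ k, (e k : A) = c k + q k • (e (k + 1) : A) := fun k => congrArg Subtype.val (he k)
  set d : ℕ → A := fun k => y k + e k with hd
  have hdq : ∀ k, q k • d (k + 1) = d k + δ k := by
    intro k
    simp only [hd, smul_add]
    rw [he k, eq_add_of_sub_eq (hcδ k).symm]
    abel
  have hdy : ∀ (m : ℤ) k, m • d k - m • y k ∈ K := by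
    intro m k
    rw [← smul_sub, hd]
    exact K.zsmul_mem (by simp) m
  have mono : ∀ {k l : ℕ}, k ≤ l → ∀ {x : A} {m : ℤ}, x - m • d k ∈ D →
      ∃ m' : ℤ, x - m' • d l ∈ D := by
    intro k l hkl
    induction l, hkl using Nat.le_induction with
    | base => exact fun h => ⟨_, h⟩
    | succ l _ ih =>
      intro x m h
      obtain ⟨m', h'⟩ := ih h
      refine ⟨m' * q l, ?_⟩
      rw [mul_smul, hdq, smul_add, ← sub_sub]
      exact D.sub_mem h' (D.zsmul_mem (hδ l) _)
  let D' : AddSubgroup A :=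
    { carrier := {x | ∃ (k : ℕ) (m : ℤ), x - m • d k ∈ D}
      zero_mem' := ⟨0, 0, by simp⟩
      add_mem' := by
        rintro x x' ⟨k, m, h⟩ ⟨k', m', h'⟩
        obtain ⟨n, h⟩ := mono (le_max_left k k') h
        obtain ⟨n', h'⟩ := mono (le_max_right k k') h'
        refine ⟨max k k', n + n', ?_⟩
        convert D.add_mem h h' using 1
        module
      neg_mem' := by
        rintro x ⟨k, m, h⟩
        refine ⟨k, -m, ?_⟩
        convert D.neg_mem h using 1
        module }
  have hD' : ∀ {x k} {m : ℤ}, x - m • d k ∈ D → x ∈ D' := fun h => ⟨_, _, h⟩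
  have hDD' : D ≤ D' := fun x hx => hD' (k := 0) (m := 0) (by simpa using hx)
  have hHH' : K ⊔ D ≤ K ⊔ D' := sup_le_sup_left hDD' K
  have hd' : ∀ k (m : ℤ), m • d k ∈ D' := fun k m => hD' (k := k) (m := m) (by simp)
  have hy' : ∀ k (m : ℤ), m • y k ∈ K ⊔ D' := by
    intro k m
    rw [← sub_sub_cancel (m • d k) (m • y k)]
    exact sub_mem (AddSubgroup.mem_sup_right (hd' k m)) (AddSubgroup.mem_sup_left (hdy m k))
  have hyH : ∀ k, y k ∉ K ⊔ D := by
    intro k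
    induction k with
    | zero => rwa [hy0]
    | succ k ih =>
      intro h
      apply ih
      rw [← sub_sub_cancel (q k • y (k + 1)) (y k)]
      exact sub_mem (AddSubgroup.zsmul_mem _ h _) (hy k)
  have key : ∀ {x k} {m : ℤ}, x - m • d k ∈ D → x - m • y k ∈ K ⊔ D := by
    intro x k m h
    rw [← sub_add_sub_cancel x (m • d k)]
    exact add_mem (hDH h) (hKH (hdy m k))
  refine ⟨D', lt_of_le_of_ne hDD' ?_, ?_, isDivClosed_of_prime ?_⟩
  · intro h
    have h1 := hy' 0 1
    rw [← h, one_smul] at h1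
    exact hyH 0 h1
  · rw [AddSubgroup.disjoint_def]
    rintro x ⟨k, m, h⟩ hxK
    by_cases hm : m = 0
    · subst hm
      rw [zero_smul, sub_zero] at h
      exact AddSubgroup.disjoint_def.1 hKD h hxK
    · refine absurd (hdiv.of_zsmul hm ?_) (hyH k)
      rw [← sub_sub_cancel x (m • y k)]
      exact sub_mem (hKH hxK) (key h)
  · intro p hp x hx
    obtain ⟨κ, hκ, x', ⟨k, m₀, h₀⟩, hκx⟩ := AddSubgroup.mem_sup.1 hx
    -- Division by `p` is scheduled at some stage `l ≥ k`, late enough to express `x'` through `d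
    -- l`.
    obtain ⟨l, hkl, hl⟩ := hyn p k
    obtain ⟨m, h⟩ := mono hkl h₀
    have h1 : p • x - m • y l ∈ K ⊔ D := by
      rw [← hκx, add_sub_assoc]
      exact add_mem (hKH hκ) (key h)
    have fin : ∀ (t : ℤ) j, x - t • y j ∈ K ⊔ D → x ∈ K ⊔ D' := by
      intro t j h
      rw [← sub_add_cancel x (t • y j)]
      exact add_mem (hHH' h) (hy' j t)
    by_cases hpm : (p : ℤ) ∣ m
    · obtain ⟨t, rfl⟩ := hpm
      refine fin t l (hdiv p hp.ne_zero _ ?_)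
      rwa [smul_sub, ← natCast_zsmul (t • y l), ← mul_smul]
    -- By Bézout `y l` is itself divisible by `p` modulo `K ⊔ D`, so the chain did divide by `p`
    -- there and `x` is congruent to `m • y (l + 1)`.
    · obtain ⟨u, v, huv⟩ := ((Nat.prime_iff_prime_int.1 hp).coprime_iff_not_dvd.2 hpm)
      have hq : q l = p := by
        refine hl ⟨u • y l + v • x, ?_⟩
        have : p • (u • y l + v • x) - y l = v • (p • x - m • y l) := by
          nth_rewrite 2 [← one_smul ℤ (y l)]
          rw [← huv]
          module
        rw [this]
        exact AddSubgroup.zsmul_mem _ h1 v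
      refine fin m (l + 1) (hdiv p hp.ne_zero _ ?_)
      have h2 := hy l
      rw [hq] at h2
      have : p • (x - m • y (l + 1)) = p • x - m • y l - m • ((p : ℤ) • y (l + 1) - y l) := by
        module
      rw [this]
      exact sub_mem h1 (AddSubgroup.zsmul_mem _ h2 m)

theorem exists_isCompl_of_solvesChains {A : Type*} [AddCommGroup A] {K : AddSubgroup A}
    (hK : SolvesChains K) (hdiv : IsDivClosed K) : ∃ D : AddSubgroup A, IsCompl K D := by
  obtain ⟨D, -, hD⟩ := zorn_le_nonempty₀
    {D : AddSubgroup A | Disjoint D K ∧ IsDivClosed (K ⊔ D)} (by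
      intro s hs hchain D₀ hD₀
      have hmem : ∀ {x}, x ∈ sSup s ↔ ∃ D ∈ s, x ∈ D :=
        AddSubgroup.mem_sSup_of_directedOn ⟨D₀, hD₀⟩ hchain.directedOn
      refine ⟨sSup s, ⟨?_, ?_⟩, fun D hD => le_sSup hD⟩
      · rw [AddSubgroup.disjoint_def]
        intro x hx hxK
        obtain ⟨D, hD, hxD⟩ := hmem.1 hx
        exact AddSubgroup.disjoint_def.1 (hs hD).1 hxD hxK
      · intro n hn x hx
        obtain ⟨κ, hκ, x', hx', h⟩ := AddSubgroup.mem_sup.1 hx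
        obtain ⟨D, hD, hxD⟩ := hmem.1 hx'
        refine sup_le_sup_left (le_sSup hD) K ((hs hD).2 n hn x ?_)
        exact AddSubgroup.mem_sup.2 ⟨κ, hκ, x', hxD, h⟩)
    ⊥ ⟨disjoint_bot_left, by rwa [sup_bot_eq]⟩
  refine ⟨D, hD.prop.1.symm, codisjoint_iff.2 ((AddSubgroup.eq_top_iff' _).2 fun a => ?_)⟩
  by_contra ha
  obtain ⟨D', hlt, hD'⟩ := exists_larger_complement hK hD.prop.1 hD.prop.2 ha
  exact hD.not_prop_of_gt hlt hD'

theorem SolvesChains.isCotorsion {C : Type u} [AddCommGroup C] (hC : SolvesChains C) :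
    IsCotorsion C := by
  intro A _ j _ htf
  exact exists_isCompl_of_solvesChains
    (hC.of_surjective j.rangeRestrict j.rangeRestrict_surjective) (isDivClosed_of_quotient htf)

/-! ### Divisible elements and copies of `ℚ` -/

section Divisibility

variable {A : Type*} [AddCommGroup A]

theorem exists_smul_eq_mul_of_isCoprime {a b : ℤ} (hab : IsCoprime a b) {y : A}
    (ha : ∃ w : A, a • w = y) (hb : ∃ w : A, b • w = y) : ∃ w : A, (a * b) • w = y := by
  obtain ⟨u, v, huv⟩ := hab
  obtain ⟨w₁, h₁⟩ := ha
  obtain ⟨w₂, h₂⟩ := hb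
  refine ⟨u • w₂ + v • w₁, ?_⟩
  have : (a * b) • (u • w₂ + v • w₁) = (u * a) • b • w₂ + (v * b) • a • w₁ := by module
  rw [this, h₁, h₂, ← add_smul, huv, one_smul]

theorem exists_smul_eq_of_prime_pow {y : A}
    (h : ∀ p : ℕ, p.Prime → ∀ k : ℕ, ∃ w : A, ((p : ℤ) ^ k) • w = y) (n : ℕ) (hn : n ≠ 0) :
    ∃ w : A, (n : ℤ) • w = y := by
  induction n using Nat.recOnPosPrimePosCoprime with
  | prime_pow p k hp _ => exact_mod_cast h p hp k
  | zero => exact absurd rfl hn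
  | one => exact ⟨y, by simp⟩
  | coprime a b ha hb hab iha ihb =>
    push_cast
    exact exists_smul_eq_mul_of_isCoprime (Nat.isCoprime_iff_coprime.2 hab)
      (iha (by omega)) (ihb (by omega))

theorem exists_smul_eq_of_pow_of_coprime {p : ℕ} (hp : p.Prime) {y : A}
    (h : ∀ k : ℕ, ∃ w : A, ((p : ℤ) ^ k) • w = y)
    (h' : ∀ n : ℕ, ¬ p ∣ n → ∃ w : A, (n : ℤ) • w = y) (n : ℕ) (hn : n ≠ 0) :
    ∃ w : A, (n : ℤ) • w = y := by
  obtain ⟨k, m, hm, rfl⟩ := Nat.exists_eq_pow_mul_and_not_dvd hn p hp.ne_one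
  push_cast
  refine exists_smul_eq_mul_of_isCoprime (IsCoprime.pow_left ?_) (h k) (h' m hm)
  exact Nat.isCoprime_iff_coprime.2 ((Nat.Prime.coprime_iff_not_dvd hp).2 hm)

/-- In a torsion-free group a nonzero element divisible by every positive integer generates a copy
of `ℚ`. -/
theorem exists_rat_embedding [IsAddTorsionFree A] {y : A} (hy : y ≠ 0)
    (h : ∀ n : ℕ, n ≠ 0 → ∃ w : A, (n : ℤ) • w = y) :
    ∃ φ : ℚ →+ A, Function.Injective φ := by
  have hex : ∀ r : ℚ, ∃ e : A, (r.den : ℤ) • e = r.num • y := fun r => by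
    obtain ⟨w, hw⟩ := h r.den r.den_nz
    exact ⟨r.num • w, by rw [smul_comm, hw]⟩
  -- Torsion-freeness makes `ψ r` unique, so additivity can be checked after clearing denominators.
  choose ψ hψ using hex
  let φ : ℚ →+ A := AddMonoidHom.mk' ψ fun r s => by
    have hne : ((r + s).den * r.den * s.den : ℤ) ≠ 0 := by
      have := (r + s).den_nz; have := r.den_nz; have := s.den_nz
      positivity
    refine zsmul_right_injective hne ?_
    have e1 : ((r + s).den * r.den * s.den : ℤ) • ψ (r + s) =
        ((r + s).num * r.den * s.den : ℤ) • y := by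
      rw [show ((r + s).den * r.den * s.den : ℤ) • ψ (r + s) =
        ((r.den * s.den : ℤ)) • ((r + s).den : ℤ) • ψ (r + s) by module, hψ]
      module
    have e2 : ((r + s).den * r.den * s.den : ℤ) • (ψ r + ψ s) =
        ((r + s).den * (r.num * s.den + s.num * r.den) : ℤ) • y := by
      rw [show ((r + s).den * r.den * s.den : ℤ) • (ψ r + ψ s) =
        ((r + s).den * s.den : ℤ) • (r.den : ℤ) • ψ r +
        ((r + s).den * r.den : ℤ) • (s.den : ℤ) • ψ s by module, hψ, hψ]
      module
    simp only
    rw [e1, e2]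
    congr 1
    have := Rat.add_num_den' r s
    linarith
  refine ⟨φ, (injective_iff_map_eq_zero φ).2 fun r hr => ?_⟩
  have h1 := hψ r
  rw [show ψ r = 0 from hr, smul_zero, eq_comm, smul_eq_zero_iff_left hy] at h1
  exact Rat.num_eq_zero.1 h1

end Divisibility

/-! ### Multiples by `p`-adic integers -/

section Padic

variable {A : Type*} [AddCommGroup A] {p : ℕ}

/-- `y` is a value of the scalar multiple `z • x`, for the `p`-adic integer `z`, in the part of `A`
divisible by all integers prime to `p`. -/
def IsPadicMultiple [Fact p.Prime] (x : A) (z : ℤ_[p]) (y : A) : Prop :=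
  (∀ n : ℕ, ¬ p ∣ n → ∃ w : A, (n : ℤ) • w = y) ∧
    ∀ k : ℕ, ∃ m : ℤ, (p : ℤ_[p]) ^ k ∣ z - m ∧ ∃ w : A, ((p : ℤ) ^ k) • w = y - m • x

variable [hp : Fact p.Prime]

theorem IsPadicMultiple.sub {x y y' : A} {z z' : ℤ_[p]} (h : IsPadicMultiple x z y)
    (h' : IsPadicMultiple x z' y') : IsPadicMultiple x (z - z') (y - y') := by
  refine ⟨fun n hn => ?_, fun k => ?_⟩
  · obtain ⟨w, hw⟩ := h.1 n hn
    obtain ⟨w', hw'⟩ := h'.1 n hn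
    exact ⟨w - w', by rw [smul_sub, hw, hw']⟩
  · obtain ⟨m, hm, w, hw⟩ := h.2 k
    obtain ⟨m', hm', w', hw'⟩ := h'.2 k
    refine ⟨m - m', ?_, w - w', ?_⟩
    · convert dvd_sub hm hm' using 1
      push_cast
      ring
    · rw [smul_sub, hw, hw']
      module

/-- The approximating integers are divisible by `p ^ k`, so `y` is too; this gives uniqueness of `z
• x`. -/
theorem IsPadicMultiple.eq_zero
    (hred : ∀ y : A, (∀ n : ℕ, n ≠ 0 → ∃ w : A, (n : ℤ) • w = y) → y = 0) {x y : A}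
    (h : IsPadicMultiple (p := p) x 0 y) : y = 0 := by
  refine hred y (exists_smul_eq_of_pow_of_coprime hp.out (fun k => ?_) h.1)
  obtain ⟨m, hm, w, hw⟩ := h.2 k
  rw [zero_sub, dvd_neg, PadicInt.pow_p_dvd_int_iff] at hm
  obtain ⟨t, rfl⟩ := hm
  exact ⟨w + t • x, by rw [smul_add, hw, smul_smul, sub_add_cancel]⟩

/-- A chain of integers converging to `z` in `ℤ_[p]` and to `0` in `ℤ_[l]` for primes `l ≠ p`. -/
theorem exists_padic_approx (z : ℤ_[p]) :
    ∃ (N q a m : ℕ → ℤ), N 0 = 1 ∧ (∀ k, N (k + 1) = N k * q k) ∧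
      (∀ k, m (k + 1) = m k + N k * a k) ∧
      (∀ k, (p : ℤ) ^ k ∣ N k) ∧ (∀ n : ℕ, ¬ p ∣ n → ∃ k, (n : ℤ) ∣ N k ∧ (n : ℤ) ∣ m k) ∧
      ∀ k, (p : ℤ_[p]) ^ k ∣ z - m k := by
  -- Omitting multiples of `p` keeps the products `r k` prime to `p`, yet each `n` prime to `p`
  -- eventually divides them.
  let s : ℕ → ℤ := fun k => if p ∣ k + 1 then 1 else (k + 1 : ℕ)
  have hs : ∀ k, IsCoprime (p : ℤ) (s k) := by
    intro k
    by_cases h : p ∣ k + 1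
    · simp only [s, if_pos h]
      exact isCoprime_one_right
    · simp only [s, if_neg h]
      exact Nat.isCoprime_iff_coprime.2 ((Nat.Prime.coprime_iff_not_dvd hp.out).2 h)
  let r : ℕ → ℤ := fun k => ∏ j ∈ Finset.range k, s j
  have hr : ∀ k, r (k + 1) = r k * s k := fun k => Finset.prod_range_succ _ _
  have hcop : ∀ k, IsCoprime ((p : ℤ) ^ k) (r k) := fun k =>
    IsCoprime.prod_right fun j _ => (hs j).pow_left
  choose u v huv using hcop
  -- Chinese remainders: `v k * r k` is 1 modulo `p ^ k` and 0 modulo `r k`.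
  let m : ℕ → ℤ := fun k => (z.appr k : ℤ) * (v k * r k)
  have hm : ∀ k, (p : ℤ_[p]) ^ k ∣ z - m k := by
    intro k
    have h1 := Ideal.mem_span_singleton.1 (PadicInt.appr_spec k z)
    have h2 : ((v k * r k : ℤ) : ℤ_[p]) = 1 - u k * (p : ℤ_[p]) ^ k := by
      rw [eq_sub_iff_add_eq', ← Int.cast_one, ← huv k]
      push_cast
      rfl
    have h3 : z - (m k : ℤ) = (z - z.appr k) + (p : ℤ_[p]) ^ k * (z.appr k * u k) := by
      simp only [m]
      rw [Int.cast_mul, h2]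
      push_cast
      ring
    rw [h3]
    exact dvd_add h1 (dvd_mul_right _ _)
  have hdvd : ∀ k, (p : ℤ) ^ k * r k ∣ m (k + 1) - m k := by
    intro k
    refine IsCoprime.mul_dvd ⟨u k, v k, huv k⟩ ?_ ?_
    · rw [← PadicInt.pow_p_dvd_int_iff]
      have h1 := dvd_sub (hm k) ((pow_dvd_pow _ k.le_succ).trans (hm (k + 1)))
      push_cast
      rwa [sub_sub_sub_cancel_left] at h1
    · refine dvd_sub ?_ ⟨z.appr k * v k, by simp only [m]; ring⟩
      exact ⟨z.appr (k + 1) * v (k + 1) * s k, by simp only [m, hr]; ring⟩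
  choose a ha using hdvd
  refine ⟨fun k => p ^ k * r k, fun k => p * s k, a, m, by simp [r], fun k => ?_, fun k => ?_,
    fun k => dvd_mul_right _ _, fun n hn => ?_, hm⟩
  · simp only [hr]
    ring
  · exact (sub_eq_iff_eq_add'.1 (ha k))
  · obtain ⟨n, rfl⟩ : ∃ n', n = n' + 1 :=
      Nat.exists_eq_succ_of_ne_zero (fun h => hn (h ▸ dvd_zero p))
    have h1 : ((n + 1 : ℕ) : ℤ) ∣ r (n + 1) := by
      rw [hr]
      simp only [s, if_neg hn]
      exact dvd_mul_left _ _
    exact ⟨n + 1, h1.mul_left _, (h1.mul_left _).mul_left _⟩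

/-- The chain sums the series `∑ (N k * a k) • x`: the candidate `y` differs from each partial value
`m k • x` by a multiple of `N k`. -/
theorem SolvesChains.exists_isPadicMultiple (hA : SolvesChains A) (x : A) (z : ℤ_[p]) :
    ∃ y, IsPadicMultiple x z y := by
  obtain ⟨N, q, a, m, hN0, hN, hm, hpN, hn, hz⟩ := exists_padic_approx z
  obtain ⟨e, he⟩ := hA q (fun k => a k • x)
  have key : ∀ k, N k • e k = e 0 + m 0 • x - m k • x := by
    intro k
    induction k with
    | zero => rw [hN0, one_smul, add_sub_cancel_right]
    | succ k ih =>
      have : N k • e k = N k • a k • x + (N k * q k) • e (k + 1) := by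
        rw [he k]
        module
      rw [hN, hm, ← sub_eq_of_eq_add' this, ih]
      module
  have hdiv : ∀ {d : ℤ} {k}, d ∣ N k → ∃ w, d • w = e 0 + m 0 • x - m k • x := by
    rintro d k ⟨t, ht⟩
    exact ⟨t • e k, by rw [← key, ht, mul_smul]⟩
  refine ⟨e 0 + m 0 • x, fun n hpn => ?_, fun k => ⟨m k, hz k, hdiv (hpN k)⟩⟩
  obtain ⟨k, hk, t, ht⟩ := hn n hpn
  obtain ⟨w, hw⟩ := hdiv hk
  refine ⟨w + t • x, ?_⟩
  rw [smul_add, hw, smul_smul, ← ht, sub_add_cancel]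

theorem exists_eq_mul_natCast_of_not_dvd {n : ℕ} (hn : ¬ p ∣ n) (z : ℤ_[p]) :
    ∃ w : ℤ_[p], z = n * w := by
  have : IsUnit (n : ℤ_[p]) := PadicInt.isUnit_iff.2
    (PadicInt.norm_natCast_eq_one_iff.2 ((Nat.Prime.coprime_iff_not_dvd hp.out).2 hn))
  exact this.dvd

/-- Torsion-freeness turns a nonzero kernel element into a unit in the kernel. Integer multiples of
a unit are `p`-adically dense, so all values are divisible by every positive integer and vanish. -/
theorem padicHom_injective [IsAddTorsionFree A]
    (hred : ∀ y : A, (∀ n : ℕ, n ≠ 0 → ∃ w : A, (n : ℤ) • w = y) → y = 0)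
    (φ : ℤ_[p] →+ A) (hφ : φ ≠ 0) : Function.Injective φ := by
  refine (injective_iff_map_eq_zero φ).2 fun z hz => ?_
  by_contra hz0
  have hu : φ (PadicInt.unitCoeff hz0 : ℤ_[p]) = 0 := by
    have h1 : (p ^ z.valuation : ℕ) • φ (PadicInt.unitCoeff hz0 : ℤ_[p]) = 0 := by
      rw [← map_nsmul, nsmul_eq_mul, ← hz]
      conv_rhs => rw [PadicInt.unitCoeff_spec hz0]
      push_cast
      rw [mul_comm]
    exact (smul_eq_zero_iff_right (pow_ne_zero _ hp.out.ne_zero)).1 h1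
  refine hφ (AddMonoidHom.ext fun w => hred _
    (exists_smul_eq_of_pow_of_coprime hp.out (fun k => ?_) fun n hn => ?_))
  · set c := w * ((PadicInt.unitCoeff hz0)⁻¹ : ℤ_[p]ˣ)
    obtain ⟨t, ht⟩ := Ideal.mem_span_singleton.1 (PadicInt.appr_spec k c)
    have hw : w = c.appr k • (PadicInt.unitCoeff hz0 : ℤ_[p]) +
        ((p : ℤ) ^ k) • (t * PadicInt.unitCoeff hz0) := by
      have h1 : w = c * PadicInt.unitCoeff hz0 := by simp [c]
      rw [nsmul_eq_mul, zsmul_eq_mul, Int.cast_pow, Int.cast_natCast, ← mul_assoc, ← ht]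
      linear_combination h1
    refine ⟨φ (t * PadicInt.unitCoeff hz0), ?_⟩
    conv_rhs => rw [hw]
    rw [map_add, map_nsmul, hu, smul_zero, zero_add, map_zsmul]
  · obtain ⟨v, rfl⟩ := exists_eq_mul_natCast_of_not_dvd hn w
    exact ⟨φ v, by rw [← map_zsmul, zsmul_eq_mul, Int.cast_natCast]⟩

end Padic

theorem SolvesChains.exists_padic_embedding {A : Type*} [AddCommGroup A] [IsAddTorsionFree A]
    (hA : SolvesChains A) [Nontrivial A]
    (hred : ∀ y : A, (∀ n : ℕ, n ≠ 0 → ∃ w : A, (n : ℤ) • w = y) → y = 0) :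
    ∃ (p : ℕ) (_ : Fact p.Prime) (φ : ℤ_[p] →+ A), Function.Injective φ := by
  obtain ⟨x, hx⟩ := exists_ne (0 : A)
  by_contra! hno
  refine hx (hred x (exists_smul_eq_of_prime_pow fun p hp k => ?_))
  have : Fact p.Prime := ⟨hp⟩
  choose ψ hψ using hA.exists_isPadicMultiple (p := p) x
  have huniq : ∀ {z y y'}, IsPadicMultiple (p := p) x z y → IsPadicMultiple x z y' → y = y' := by
    intro z y y' h h'
    have := h.sub h'
    rw [sub_self] at this
    exact sub_eq_zero.1 (this.eq_zero hred)
  let φ : ℤ_[p] →+ A := AddMonoidHom.ofMapSub ψ fun z z' => huniq (hψ _) ((hψ z).sub (hψ z'))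
  -- With no copy of `ℤ_[p]` available, `φ` vanishes; its value at 1 then shows that `x` is
  -- divisible by `p ^ k`.
  have hφ : φ = 0 := by
    by_contra h
    exact hno p this φ (padicHom_injective hred φ h)
  have h1 := hψ 1
  rw [show ψ 1 = 0 from DFunLike.congr_fun hφ 1] at h1
  obtain ⟨m, hm, w, hw⟩ := h1.2 k
  rw [← Int.cast_one, ← Int.cast_sub, PadicInt.pow_p_dvd_int_iff] at hm
  obtain ⟨t, ht⟩ := hm
  refine ⟨t • x - w, ?_⟩
  rw [smul_sub, hw, smul_smul, ← ht]
  module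

theorem SolvesChains.exists_finite_order_or_rat_or_padic {A : Type*} [AddCommGroup A]
    (hA : SolvesChains A) [Nontrivial A] :
    (∃ x : A, x ≠ 0 ∧ IsOfFinAddOrder x) ∨ (∃ φ : ℚ →+ A, Function.Injective φ) ∨
      ∃ (p : ℕ) (_ : Fact p.Prime) (φ : ℤ_[p] →+ A), Function.Injective φ := by
  by_cases ht : ∃ x : A, x ≠ 0 ∧ IsOfFinAddOrder x
  · exact Or.inl ht
  have : IsAddTorsionFree A := isAddTorsionFree_iff_not_isOfFinAddOrder.2
    fun x hx hfin => ht ⟨x, hx, hfin⟩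
  by_cases hred : ∀ y : A, (∀ n : ℕ, n ≠ 0 → ∃ w : A, (n : ℤ) • w = y) → y = 0
  · exact Or.inr (Or.inr (hA.exists_padic_embedding hred))
  · push Not at hred
    obtain ⟨y, hy, hy0⟩ := hred
    exact Or.inr (Or.inl (exists_rat_embedding hy0 hy))

/-! ### Discarding and comparing factors -/

section Factoring

variable {I : Type*} {R : I → Type*} [∀ i, NonUnitalNonAssocRing (R i)]

/-- Extension by zero from a product over a subtype to the full product. -/
noncomputable def extendByZero {K : Type*} (S : K → Prop) (T : K → Type*)
    [∀ k, NonUnitalNonAssocRing (T k)] : (∀ k : Subtype S, T k) →ₙ+* (∀ k, T k) := by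
  classical
  exact
  { toFun := fun x k => if h : S k then x ⟨k, h⟩ else 0
    map_mul' := fun x y => by
      funext k
      by_cases h : S k <;> simp [h]
    map_zero' := by
      funext k
      by_cases h : S k <;> simp [h]
    map_add' := fun x y => by
      funext k
      by_cases h : S k <;> simp [h] }

theorem extendByZero_of_mem {K : Type*} {S : K → Prop} {T : K → Type*}
    [∀ k, NonUnitalNonAssocRing (T k)] (x : ∀ k : Subtype S, T k) {k : K} (h : S k) :
    extendByZero S T x k = x ⟨k, h⟩ :=
  dif_pos h

/-- Reindexing a product of rings. -/
def reindexProd {K K' : Type*} (e : K' ≃ K) (T : K → Type*)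
    [∀ k, NonUnitalNonAssocRing (T k)] : (∀ k', T (e k')) →ₙ+* (∀ k, T k) where
  toFun := e.piCongrLeft T
  map_mul' x y := by
    funext k
    obtain ⟨k, rfl⟩ := e.surjective k
    simp only [Pi.mul_apply, Equiv.piCongrLeft_apply_apply]
  map_zero' := by
    funext k
    obtain ⟨k, rfl⟩ := e.surjective k
    simp only [Pi.zero_apply, Equiv.piCongrLeft_apply_apply]
  map_add' x y := by
    funext k
    obtain ⟨k, rfl⟩ := e.surjective k
    simp only [Pi.add_apply, Equiv.piCongrLeft_apply_apply]

theorem reindexProd_apply {K K' : Type*} (e : K' ≃ K) (T : K → Type*)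
    [∀ k, NonUnitalNonAssocRing (T k)] (x : ∀ k', T (e k')) (k' : K') :
    reindexProd e T x (e k') = x k' :=
  Equiv.piCongrLeft_apply_apply _ _ _ _

variable {C : Type*} [NonUnitalNonAssocRing C]

/-- If every component at an ultrafilter that is not countably complete vanishes, such ultrafilters
can be dropped. -/
theorem factorsThroughCountablyComplete_of_single_eq_zero {n : ℕ} (U : Fin n → Ultrafilter I)
    (g : (∀ k, Ultraprod R (U k)) →ₙ+* C)
    (hg : ∀ k, ¬ CountableInterFilter (U k : Filter I) →
      ∀ x : Ultraprod R (U k), g (Pi.single k x) = 0) :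
    FactorsThroughCountablyCompleteUltraprods (g.comp (toUltraprods R U)) := by
  classical
  let S : Fin n → Prop := fun k => CountableInterFilter (U k : Filter I)
  let e : Fin (Fintype.card (Subtype S)) ≃ Subtype S := (Fintype.equivFin (Subtype S)).symm
  let ext := extendByZero S fun k => Ultraprod R (U k)
  refine ⟨_, fun k => U (e k),
    (g.comp ext).comp (reindexProd e fun k : Subtype S => Ultraprod R (U k)), fun k => (e k).2, ?_⟩
  ext x
  change g (toUltraprods R U x) = g (ext (reindexProd e _ (toUltraprods R (fun k => U (e k)) x)))
  -- The difference is split into coordinates: it vanishes at the retained indices, and `g` kills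
  -- the others.
  rw [← sub_eq_zero, ← map_sub, ← Finset.univ_sum_single
    (toUltraprods R U x - ext (reindexProd e _ (toUltraprods R (fun k => U (e k)) x))), map_sum]
  refine Finset.sum_eq_zero fun k _ => ?_
  by_cases hk : S k
  · convert map_zero g
    rw [Pi.single_eq_zero_iff, Pi.sub_apply, sub_eq_zero]
    have h1 := extendByZero_of_mem (T := fun k => Ultraprod R (U k))
      (reindexProd e _ (toUltraprods R (fun k => U (e k)) x)) hk
    refine Eq.trans ?_ h1.symm
    obtain ⟨k', hk'⟩ := e.surjective ⟨k, hk⟩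
    obtain rfl : (e k' : Fin n) = k := congrArg Subtype.val hk'
    exact (reindexProd_apply e (fun k : Subtype S => Ultraprod R (U k))
      (toUltraprods R (fun k => U (e k)) x) k').symm
  · exact hg k hk _

theorem exists_solvesChains_range {h : (∀ i, R i) →ₙ+* C} (hU : FactorsThroughUltraprods h)
    (hc : ¬ FactorsThroughCountablyCompleteUltraprods h) :
    ∃ D : AddSubgroup C, D ≠ ⊥ ∧ SolvesChains D := by
  classical
  obtain ⟨n, U, g, rfl⟩ := hU
  have hex : ∃ k, ¬ CountableInterFilter (U k : Filter I) ∧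
      ∃ x : Ultraprod R (U k), g (Pi.single k x) ≠ 0 := by
    by_contra! hno
    exact hc (factorsThroughCountablyComplete_of_single_eq_zero U g hno)
  obtain ⟨k, hk, x, hx⟩ := hex
  let φ : Ultraprod R (U k) →+ C :=
    (g : (∀ k, Ultraprod R (U k)) →+ C).comp (AddMonoidHom.single (fun k => Ultraprod R (U k)) k)
  refine ⟨φ.range, fun h => hx ?_, (solvesChains_ultraprod R (U k) hk).of_surjective
    φ.rangeRestrict φ.rangeRestrict_surjective⟩
  exact (AddSubgroup.eq_bot_iff_forall _).1 h _ ⟨x, rfl⟩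

theorem factorsThroughFiniteProd_of_pure {n : ℕ} (U : Fin n → Ultrafilter I)
    (g : (∀ k, Ultraprod R (U k)) →ₙ+* C) (hU : ∀ k, ∃ a, U k = pure a) :
    FactorsThroughFiniteProd (g.comp (toUltraprods R U)) := by
  classical
  choose a ha using hU
  -- Zeroing the coordinates outside the image of `a` is invisible to the principal ultrafilters.
  refine ⟨Finset.univ.image a, (g.comp (toUltraprods R U)).comp (extendByZero _ R), ?_⟩
  ext x
  refine congrArg g (funext fun k => ultraprodMk_eq_iff.2 ?_)
  rw [ha k]
  exact (extendByZero_of_mem (toFinsetProd R _ x)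
    (Finset.mem_image_of_mem a (Finset.mem_univ k))).symm

/-- The isomorphism from an ultraproduct over a principal ultrafilter to the factor, as a
homomorphism. -/
def ultraprodPureEval (R : I → Type*) [∀ i, NonUnitalNonAssocRing (R i)] (a : I) :
    Ultraprod R (pure a) →ₙ+* R a where
  toFun := Quotient.lift (fun x : ∀ i, R i => x a) fun _ _ h => h
  map_mul' x y := by
    obtain ⟨x, rfl⟩ := Quot.exists_rep x
    obtain ⟨y, rfl⟩ := Quot.exists_rep y
    rfl
  map_zero' := rfl
  map_add' x y := by
    obtain ⟨x, rfl⟩ := Quot.exists_rep x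
    obtain ⟨y, rfl⟩ := Quot.exists_rep y
    rfl

theorem FactorsThroughFiniteProd.factorsThroughCountablyComplete {h : (∀ i, R i) →ₙ+* C}
    (hf : FactorsThroughFiniteProd h) : FactorsThroughCountablyCompleteUltraprods h := by
  obtain ⟨J, g, rfl⟩ := hf
  let e : Fin (Fintype.card J) ≃ J := (Fintype.equivFin J).symm
  let ev : (∀ k : Fin (Fintype.card J), Ultraprod R (pure (e k : I))) →ₙ+*
      (∀ k : Fin (Fintype.card J), R (e k)) :=
    { toFun := fun x k => ultraprodPureEval R (e k) (x k)
      map_mul' := fun x y => funext fun k => map_mul _ _ _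
      map_zero' := funext fun k => map_zero _
      map_add' := fun x y => funext fun k => map_add _ _ _ }
  refine ⟨Fintype.card J, fun k => pure (e k : I),
    (g.comp (reindexProd e fun i : J => R i)).comp ev, fun k => ?_, ?_⟩
  · rw [Ultrafilter.coe_pure, ← Filter.principal_singleton]
    infer_instance
  · ext x
    refine congrArg g (funext fun i => ?_)
    obtain ⟨k, rfl⟩ := e.surjective i
    exact (reindexProd_apply e (fun i : J => R i) (fun k => x (e k)) k).symm

end Factoring

/-! ### Measurable cardinals -/

/-- A nonprincipal countably complete ultrafilter on `I` yields an uncountable measurable cardinal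
of size at most `#I`. -/
theorem exists_isUncountableMeasurable_le {I : Type u} (U : Ultrafilter I)
    (hU : CountableInterFilter (U : Filter I)) (hpure : ∀ a, U ≠ pure a) :
    ∃ κ : Cardinal.{u}, IsUncountableMeasurable κ ∧ κ ≤ #I := by
  classical
  have hsing : ∀ a, ({a} : Set I)ᶜ ∈ U := by
    intro a
    rw [Ultrafilter.compl_mem_iff_notMem]
    intro h
    exact hpure a (Ultrafilter.eq_of_le ((Ultrafilter.coe_pure a).symm ▸
      (Filter.le_pure_iff.2 h)))
  let Bad : Cardinal.{u} → Prop := fun κ =>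
    ∃ S : Set (Set I), #S = κ ∧ (∀ s ∈ S, s ∈ U) ∧ ⋂₀ S ∉ U
  let S₁ : Set (Set I) := Set.range fun a : I => ({a} : Set I)ᶜ
  have hbad : Bad #S₁ := by
    refine ⟨S₁, rfl, ?_, ?_⟩
    · rintro _ ⟨a, rfl⟩
      exact hsing a
    · have : ⋂₀ S₁ = ∅ := by
        refine Set.eq_empty_iff_forall_notMem.2 fun a ha => ?_
        exact ha _ ⟨a, rfl⟩ rfl
      rw [this]
      exact Ultrafilter.empty_notMem
  let W : Set Cardinal.{u} := {κ | Bad κ}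
  have hW : W.Nonempty := ⟨_, hbad⟩
  obtain ⟨S, hSκ, hSU, hSn⟩ : Bad (sInf W) := csInf_mem hW
  -- `κ` is the least size of a family in `U` whose intersection is not in `U`.
  set κ := sInf W
  have hmin : ∀ S' : Set (Set I), #S' < κ → (∀ s ∈ S', s ∈ U) → ⋂₀ S' ∈ U := by
    intro S' hlt hS'
    by_contra hn
    exact not_le.2 hlt (csInf_le' (show #S' ∈ W from ⟨S', rfl, hS', hn⟩))
  refine ⟨κ, ⟨?_, S, ?_⟩, (csInf_le' (show #S₁ ∈ W from hbad)).trans mk_range_le⟩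
  · rw [← hSκ, ← not_le, Cardinal.le_aleph0_iff_set_countable]
    exact fun hcount => hSn (hU.countable_sInter_mem S hcount hSU)
  have hne : Nonempty S := by
    by_contra he
    rw [not_nonempty_iff, Set.isEmpty_coe_sort] at he
    exact hSn (by rw [he, Set.sInter_empty]; exact Filter.univ_mem)
  have hφ : ∀ i, ∃ s : S, i ∉ ⋂₀ S → i ∉ (s : Set I) := by
    intro i
    by_cases hi : i ∈ ⋂₀ S
    · exact ⟨hne.some, fun h => absurd hi h⟩
    · obtain ⟨s, hs, his⟩ : ∃ s ∈ S, i ∉ s := by simpa using hi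
      exact ⟨⟨s, hs⟩, fun _ => his⟩
  choose φ hφ using hφ
  -- Minimality of `κ` gives completeness of the pushforward. It is nonprincipal because, off `⋂₀
  -- S`, the fibre of `φ` over `s` misses `s ∈ U`.
  refine ⟨U.map φ, hSκ, ⟨fun T hT hTU => ?_⟩, fun s hs => ?_⟩
  · have h1 := hmin ((fun t => φ ⁻¹' t) '' T) (mk_image_le.trans_lt hT) (by
      rintro _ ⟨t, ht, rfl⟩
      exact hTU t ht)
    rw [Set.sInter_image] at h1
    change φ ⁻¹' ⋂₀ T ∈ U
    rwa [Set.preimage_sInter]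
  · have h1 : φ ⁻¹' {s} ∈ U := by
      change {s} ∈ U.map φ
      rw [hs]
      exact Set.mem_singleton s
    have h2 : (⋂₀ S)ᶜ ∈ U := Ultrafilter.compl_mem_iff_notMem.2 hSn
    obtain ⟨i, ⟨hi1, hi2⟩, hi3⟩ := U.nonempty_of_mem
      (Filter.inter_mem (Filter.inter_mem h1 h2) (hSU s s.2))
    have h3 := hφ i hi2
    rw [Set.mem_singleton_iff.1 hi1] at h3
    exact h3 hi3

theorem theorem8p4 {I : Type*} {R : I → Type*} [∀ i, NonUnitalNonAssocRing (R i)]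
    {B : Type*} [NonUnitalNonAssocRing B]
    (f : (∀ i, R i) →ₙ+* B) (hf : Function.Surjective f) :
    (FactorsThroughUltraprods ((piZ B).comp f) →
      ¬ FactorsThroughCountablyCompleteUltraprods ((piZ B).comp f) →
        (∃ C : AddSubgroup (ModZ B), C ≠ ⊥ ∧ IsCotorsion C) ∧
        ((∃ x : ModZ B, x ≠ 0 ∧ IsOfFinAddOrder x) ∨
          (∃ φ : ℚ →+ ModZ B, Function.Injective φ) ∨
          (∃ (p : ℕ) (_ : Fact p.Prime) (φ : ℤ_[p] →+ ModZ B), Function.Injective φ))) ∧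
    ((∀ κ : Cardinal, IsUncountableMeasurable κ → #I < κ) →
      (¬ FactorsThroughCountablyCompleteUltraprods ((piZ B).comp f) ↔
        ¬ FactorsThroughFiniteProd ((piZ B).comp f))) := by
  refine ⟨fun hU hc => ?_, fun hκ => not_congr ⟨?_, fun h => h.factorsThroughCountablyComplete⟩⟩
  · obtain ⟨D, hD, hDs⟩ := exists_solvesChains_range hU hc
    have : Nontrivial D := (AddSubgroup.nontrivial_iff_ne_bot D).2 hD
    refine ⟨⟨D, hD, hDs.isCotorsion⟩, ?_⟩
    rcases hDs.exists_finite_order_or_rat_or_padic with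
      ⟨x, hx, hfin⟩ | ⟨φ, hφ⟩ | ⟨p, hp, φ, hφ⟩
    · exact Or.inl ⟨x, fun h => hx (Subtype.ext h), D.subtype.isOfFinAddOrder hfin⟩
    · exact Or.inr (Or.inl ⟨D.subtype.comp φ, D.subtype_injective.comp hφ⟩)
    · exact Or.inr (Or.inr ⟨p, hp, D.subtype.comp φ, D.subtype_injective.comp hφ⟩)
  · rintro ⟨n, U, g, hU, hg⟩
    rw [hg]
    refine factorsThroughFiniteProd_of_pure U g fun k => ?_
    by_contra! hk
    obtain ⟨κ, hm, hle⟩ := exists_isUncountableMeasurable_le (U k) (hU k) hk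
    exact not_lt.2 hle (hκ κ hm)
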